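/- Let $R$ be an associative ring with identity and let $M$ be a finitely generated unitary right $R$-module that is quasi-projective, i.e. for every epimorphism $\pi\colon M\to N$ and every homomorphism $f\colon M\to N$ there is $g\in\operatorname{End}_R(M)$ with $\pi g=f$. A module $N$ is called $M$-generated if there is an epimorphism $M^{(I)}\to N$ for some index set $I$, and $\sigma[M]$ denotes the full subcategory of right $R$-modules consisting of all submodules (up to isomorphism) of $M$-generated modules. $M$ is a generator of $\sigma[M]$ if every module in $\sigma[M]$ is $M$-generated. $M$ is abelian endoregular if $\operatorname{End}_R(M)$ is a von Neumann regular ring (every $a$ satisfies $a=axa$ for some $x$) all of whose idempotents are central. A module $Q$ is $M$-injective if for every monomorphism $\eta\colon N\to M$ and every homomorphism $f\colon N\to Q$ there is a homomorphism $g\colon M\to Q$ with $g\eta=f$; $M$ is co-semisimple if every simple module in $\sigma[M]$ is $M$-injective. A submodule $N\le M$ is fully invariant if $\varphi(N)\subseteq N$ for all $\varphi\in\operatorname{End}_R(M)$; $M$ is duo (resp. quasi-duo) if every submodule (resp. every maximal submodule) of $M$ is fully invariant. Then the following conditions are equivalent: (a) $M$ is abelian endoregular and a generator of $\sigma[M]$;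 (b) $M$ is co-semisimple and quasi-duo; (c) $M$ is duo and a generator of $\sigma[M]$, and every cyclic submodule of $M$ is a direct summand of $M$. -/

import Mathlib

universe u v

/-- A ring is von Neumann regular if every element `a` has an `x` with `a * x * a = a`. -/
def IsVonNeumannRegular (S : Type u) [Ring S] : Prop :=
  ∀ a : S, ∃ x : S, a * x * a = a

/-- A ring is abelian if every idempotent is central. -/
def IsAbelianRing (S : Type u) [Ring S] : Prop :=
  ∀ e : S, IsIdempotentElem e → ∀ a : S, Commute e a

/-! The module notions below are stated for left modules over a ring `A`; right `R`-modules are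
the case `A = Rᵐᵒᵖ`. Auxiliary modules range over the universe of `M`. This loses nothing: sources
of monomorphisms into `M`, targets of epimorphisms from `M` and finitely generated modules in
`σ[M]` (subquotients of some `Mⁿ`) are isomorphic to modules in that universe, and a module is
`M`-generated as soon as its finitely generated submodules are. -/

section ModuleNotions

variable (A : Type u) [Ring A] (M : Type v) [AddCommGroup M] [Module A M]

/-- `M` is abelian endoregular: `End(M)` is an abelian von Neumann regular ring. -/
def IsAbelianEndoregular : Prop :=
  IsVonNeumannRegular (Module.End A M) ∧ IsAbelianRing (Module.End A M)

/-- `M` is quasi-projective: every homomorphism `M → N` lifts along every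
epimorphism `M → N`. -/
def IsQuasiProjective : Prop :=
  ∀ (N : Type v) [AddCommGroup N] [Module A N] (π : M →ₗ[A] N), Function.Surjective π →
    ∀ f : M →ₗ[A] N, ∃ g : M →ₗ[A] M, π ∘ₗ g = f

/-- `Q` is `M`-injective: for every monomorphism `η : N → M`, every homomorphism `N → Q`
extends along `η`. -/
def IsRelativelyInjective (Q : Type v) [AddCommGroup Q] [Module A Q] : Prop :=
  ∀ (N : Type v) [AddCommGroup N] [Module A N] (η : N →ₗ[A] M), Function.Injective η →
    ∀ f : N →ₗ[A] Q, ∃ g : M →ₗ[A] Q, g ∘ₗ η = f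

/-- `N` is `M`-generated: there is an epimorphism `M^(I) → N` for some index set `I`. -/
def IsGeneratedBy (N : Type v) [AddCommGroup N] [Module A N] : Prop :=
  ∃ (I : Type v) (f : (I →₀ M) →ₗ[A] N), Function.Surjective f

/-- `N` is `M`-subgenerated, that is, an object of `σ[M]`: it embeds in
an `M`-generated module. -/
def IsSubgeneratedBy (N : Type v) [AddCommGroup N] [Module A N] : Prop :=
  ∃ (G : Type v) (_ : AddCommGroup G) (_ : Module A G),
    IsGeneratedBy A M G ∧ ∃ i : N →ₗ[A] G, Function.Injective i

/-- `M` is a generator of `σ[M]`: every module in `σ[M]` is `M`-generated. -/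
def IsGeneratorOfSigma : Prop :=
  ∀ (N : Type v) [AddCommGroup N] [Module A N],
    IsSubgeneratedBy A M N → IsGeneratedBy A M N

/-- `M` is co-semisimple: every simple module in `σ[M]` is `M`-injective. -/
def IsCosemisimple : Prop :=
  ∀ (T : Type v) [AddCommGroup T] [Module A T], IsSimpleModule A T →
    IsSubgeneratedBy A M T → IsRelativelyInjective A M T

/-- `M` is duo: every submodule is fully invariant. -/
def IsDuo : Prop :=
  ∀ N : Submodule A M, N.IsFullyInvariant

/-- `M` is quasi-duo: every maximal submodule is fully invariant. -/
def IsQuasiDuo : Prop :=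
  ∀ N : Submodule A M, IsCoatom N → N.IsFullyInvariant

/-- Every cyclic submodule of `M` is a direct summand of `M`. -/
def CyclicSubmodulesAreSummands : Prop :=
  ∀ x : M, ∃ K : Submodule A M, IsCompl (Submodule.span A {x}) K

end ModuleNotions

/-!
The proof runs through (a) ⇒ (c) ⇒ (b) ⇒ (a); the ring may be arbitrary.

*(a) ⇒ (c).* Since `M` generates its submodules and images of endomorphisms are images of central
idempotents, every element `x` of a submodule `N` is fixed by a central idempotent `e` with range
in `N` (`IsAbelianEndoregular.exists_idempotent`). Hence `φ x = e (φ x) ∈ N` for all `φ`, and for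
`N` generated by `x` the range of `e` is `N`.

*(c) ⇒ (b).* In a duo module idempotent endomorphisms are central. A nonzero homomorphism from
a submodule of `M` to a simple module is nonzero on some cyclic summand `e M`; by quasi-projectivity
it vanishes on the elements killed by `e`, since `e` is central, and so it extends to `M` by zero on
the complement of `e M` (`IsDuo.isCosemisimple`).

*(b) ⇒ (a).* In a co-semisimple module every submodule is an intersection of maximal ones
(`IsCosemisimple.exists_isCoatom`). By Schur's lemma, a maximal submodule (fully invariant by
hypothesis) that contains the range of `φ * φ` contains that of `φ`; so both ranges agree, and
quasi-projectivity gives `φ = φ * φ * g`, that is, `End(M)` is strongly regular. That `M` generates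
`σ[M]` (`IsCosemisimple.isGeneratorOfSigma`) needs two facts: simple modules in `σ[M]` are images of
`M`, by their `M`-injectivity (`IsCosemisimple.exists_hom_ne_zero`), and `M`, being finitely
generated and quasi-projective, is projective in `σ[M]` (`IsQuasiProjective.exists_lift_finsupp`).
-/

open Submodule

section AuxiliaryModules

variable {A : Type u} [Ring A] {M : Type v} [AddCommGroup M] [Module A M]

/-! ### Submodules and quotients -/

theorem injective_mapQ_map {N G : Type v} [AddCommGroup N] [Module A N] [AddCommGroup G]
    [Module A G] {i : N →ₗ[A] G} (hi : Function.Injective i) (L : Submodule A N) :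
    Function.Injective (L.mapQ (L.map i) i (le_comap_map i L)) := by
  rw [← LinearMap.ker_eq_bot, ker_mapQ, comap_map_eq_of_injective hi, ← le_bot_iff]
  rintro _ ⟨x, hx, rfl⟩
  simpa using hx

/-- If `L` is maximal among the submodules that contain `K` and avoid `x`, then the image of `x`
generates the least nonzero submodule of the quotient by `L`. -/
theorem exists_isAtom_span_mkQ (K : Submodule A M) {x : M} (hx : x ∉ K) :
    ∃ L : Submodule A M, K ≤ L ∧ x ∉ L ∧ IsAtom (span A {L.mkQ x}) := by
  obtain ⟨L, hKL, hL⟩ := zorn_le_nonempty₀ {L : Submodule A M | x ∉ L}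
    (fun c hc hchain y hy => ⟨sSup c, fun h => by
      obtain ⟨z, hz, hxz⟩ := (mem_sSup_of_directed ⟨y, hy⟩ hchain.directedOn).1 h
      exact hc hz hxz, fun z hz => le_sSup hz⟩) K hx
  have hxL : x ∉ L := hL.prop
  refine ⟨L, hKL, hxL, ?_, fun P hP => ?_⟩
  · simpa [span_singleton_eq_bot] using hxL
  · -- if `P ≠ 0`, its preimage is strictly larger than `L`, hence contains `x`
    by_contra hne
    have hle : L ≤ P.comap L.mkQ := by
      simpa using LinearMap.ker_le_comap (f := L.mkQ) (p := P)
    have hx' : x ∈ P.comap L.mkQ := by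
      by_contra hxP
      refine hne (eq_bot_iff.2 fun z hz => ?_)
      obtain ⟨y, rfl⟩ := L.mkQ_surjective z
      have : y ∈ L := hL.le_of_ge hxP hle hz
      simpa using this
    exact hP.not_ge ((span_singleton_le_iff_mem _ _).2 hx')

/-! ### Generation and subgeneration by `M` -/

theorem IsSubgeneratedBy.submodule_quotient {N : Type v} [AddCommGroup N] [Module A N]
    (hN : IsSubgeneratedBy A M N) (L : Submodule A N) (T : Submodule A (N ⧸ L)) :
    IsSubgeneratedBy A M T := by
  obtain ⟨G, _, _, ⟨I, q, hq⟩, i, hi⟩ := hN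
  refine ⟨G ⧸ L.map i, inferInstance, inferInstance,
    ⟨I, (L.map i).mkQ ∘ₗ q, (mkQ_surjective _).comp hq⟩,
    L.mapQ (L.map i) i (le_comap_map i L) ∘ₗ T.subtype,
    (injective_mapQ_map hi L).comp T.injective_subtype⟩

variable (A M) in
theorem isGeneratedBy_self : IsGeneratedBy A M M :=
  ⟨PUnit, Finsupp.lapply PUnit.unit, fun m => ⟨Finsupp.single PUnit.unit m, by simp⟩⟩

variable (A M) in
theorem isSubgeneratedBy_self : IsSubgeneratedBy A M M :=
  ⟨M, _, _, isGeneratedBy_self A M, LinearMap.id, Function.injective_id⟩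

theorem IsSubgeneratedBy.submodule {N : Type v} [AddCommGroup N] [Module A N]
    (hN : IsSubgeneratedBy A M N) (T : Submodule A N) : IsSubgeneratedBy A M T := by
  obtain ⟨G, _, _, hG, i, hi⟩ := hN
  exact ⟨G, _, _, hG, i ∘ₗ T.subtype, hi.comp T.injective_subtype⟩

theorem isGeneratedBy_iff_iSup_range {N : Type v} [AddCommGroup N] [Module A N] :
    IsGeneratedBy A M N ↔ ⨆ φ : M →ₗ[A] N, LinearMap.range φ = ⊤ := by
  constructor
  · rintro ⟨I, f, hf⟩
    rw [eq_top_iff]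
    rintro n -
    obtain ⟨y, rfl⟩ := hf n
    induction y using Finsupp.induction_linear with
    | zero => simp
    | add a b ha hb => rw [map_add]; exact add_mem ha hb
    | single i m => exact mem_iSup_of_mem (f ∘ₗ Finsupp.lsingle i) ⟨m, rfl⟩
  · intro h
    refine ⟨M →ₗ[A] N, Finsupp.lsum ℕ fun φ => φ, ?_⟩
    rw [← LinearMap.range_eq_top, eq_top_iff, ← h]
    refine iSup_le fun φ => ?_
    rintro _ ⟨m, rfl⟩
    exact ⟨Finsupp.single φ m, by simp⟩

/-! ### Projectivity of `M` relative to `σ[M]` -/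

theorem IsQuasiProjective.exists_lift_of_range_le (hqp : IsQuasiProjective A M)
    {N : Type v} [AddCommGroup N] [Module A N] {a b : M →ₗ[A] N}
    (h : LinearMap.range b ≤ LinearMap.range a) : ∃ g : M →ₗ[A] M, a ∘ₗ g = b := by
  obtain ⟨g, hg⟩ := hqp (LinearMap.range a) a.rangeRestrict a.surjective_rangeRestrict
    (b.codRestrict _ fun m => h ⟨m, rfl⟩)
  refine ⟨g, LinearMap.ext fun m => ?_⟩
  simpa using congrArg Subtype.val (LinearMap.congr_fun hg m)

/-- Induction on `s`: lift along the summand indexed by a new `i` modulo the image of the others;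
the error then has its range in the image of the others. -/
theorem IsQuasiProjective.exists_lift_of_range_le_map_supported (hqp : IsQuasiProjective A M)
    {I N : Type v} [AddCommGroup N] [Module A N] (p : (I →₀ M) →ₗ[A] N) (s : Finset I) :
    ∀ h : M →ₗ[A] N, LinearMap.range h ≤ (Finsupp.supported M A (s : Set I)).map p →
      ∃ g : M →ₗ[A] (I →₀ M), p ∘ₗ g = h := by
  classical
  induction s using Finset.induction_on with
  | empty =>
    intro h hh
    refine ⟨0, ?_⟩
    have : LinearMap.range h ≤ ⊥ := by simpa using hh
    rw [LinearMap.comp_zero, LinearMap.range_eq_bot.1 (le_bot_iff.1 this)]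
  | insert i s _ ih =>
    intro h hh
    -- first lift modulo the image of the summands indexed by `s`
    set Q := (Finsupp.supported M A (s : Set I)).map p
    obtain ⟨g, hg⟩ := hqp.exists_lift_of_range_le
      (a := Q.mkQ ∘ₗ p ∘ₗ Finsupp.lsingle i) (b := Q.mkQ ∘ₗ h) (by
        rintro _ ⟨m, rfl⟩
        obtain ⟨y, hy, hym⟩ := hh ⟨m, rfl⟩
        refine ⟨y i, ?_⟩
        simp only [LinearMap.comp_apply, ← hym, mkQ_apply, Finsupp.lsingle_apply]
        rw [eq_comm, Submodule.Quotient.eq, ← map_sub]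
        refine mem_map_of_mem ?_
        rw [SetLike.mem_coe, Finsupp.mem_supported] at hy
        rw [Finsupp.mem_supported']
        intro j hj
        by_cases hji : j = i
        · simp [hji]
        · rw [Finsupp.sub_apply, Finsupp.single_eq_of_ne hji, sub_zero]
          by_contra hne
          have := hy (Finsupp.mem_support_iff.2 hne)
          simp_all)
    obtain ⟨g', hg'⟩ := ih (h - p ∘ₗ Finsupp.lsingle i ∘ₗ g) (by
      rintro _ ⟨m, rfl⟩
      have := LinearMap.congr_fun hg m
      simp only [LinearMap.comp_apply, mkQ_apply] at this
      exact (Submodule.Quotient.eq _).1 this.symm)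
    exact ⟨g' + Finsupp.lsingle i ∘ₗ g, by rw [LinearMap.comp_add, hg']; abel⟩

/-- Finite generation bounds the range of `h` by the image of finitely many summands. As every
module of `σ[M]` embeds in some such `N`, this yields the projectivity of `M` in `σ[M]`. -/
theorem IsQuasiProjective.exists_lift_finsupp [Module.Finite A M] (hqp : IsQuasiProjective A M)
    {I N : Type v} [AddCommGroup N] [Module A N] (p : (I →₀ M) →ₗ[A] N)
    (hp : Function.Surjective p) (h : M →ₗ[A] N) : ∃ g : M →ₗ[A] (I →₀ M), p ∘ₗ g = h := by
  classical
  obtain ⟨S, hS⟩ := Module.Finite.fg_top (R := A) (M := M)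
  choose y hy using fun m => hp (h m)
  refine hqp.exists_lift_of_range_le_map_supported p (S.biUnion fun m => (y m).support) h ?_
  rw [LinearMap.range_eq_map, ← hS, map_span, span_le]
  rintro _ ⟨m, hm, rfl⟩
  refine ⟨y m, ?_, hy m⟩
  rw [SetLike.mem_coe, Finsupp.mem_supported]
  exact_mod_cast Finset.subset_biUnion_of_mem (fun m => (y m).support) hm

/-! ### Co-semisimple modules -/

/-- If an `M`-injective module `T` admits no nonzero homomorphism from `M`, then it admits none from
any submodule `Y` of a direct sum of copies of `M`. The induction is on the support of the element
`y` at which the homomorphism is evaluated, for all `Y` at once. -/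
theorem IsRelativelyInjective.eq_zero_of_forall_hom_eq_zero {T : Type v} [AddCommGroup T]
    [Module A T] (hT : IsRelativelyInjective A M T) (h0 : ∀ h : M →ₗ[A] T, h = 0)
    {I : Type v} (y : I →₀ M) :
    ∀ (Y : Submodule A (I →₀ M)) (hy : y ∈ Y) (f : Y →ₗ[A] T), f ⟨y, hy⟩ = 0 := by
  classical
  induction y using Finsupp.induction with
  | zero => exact fun Y hy f => map_zero f
  | single_add i m y hi hm ih =>
    intro Y hy f
    -- `e` erases the `i`-th coordinate; `f` vanishes on its kernel, so factors through its image
    let e : Y →ₗ[A] (I →₀ M) := (LinearMap.id - Finsupp.lsingle i ∘ₗ Finsupp.lapply i) ∘ₗ Y.subtype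
    have hker : LinearMap.ker e ≤ LinearMap.ker f := by
      rintro ⟨z, hz⟩ hez
      have hz' : z = Finsupp.single i (z i) := by
        simpa [e, sub_eq_zero] using hez
      obtain ⟨g, hg⟩ := hT (Y.comap (Finsupp.lsingle i)) (Submodule.subtype _) (injective_subtype _)
        (f ∘ₗ (Finsupp.lsingle i).restrict fun _ h => h)
      have := LinearMap.congr_fun hg ⟨z i, by simpa [← hz'] using hz⟩
      rw [h0 g] at this
      simp only [LinearMap.zero_comp, LinearMap.zero_apply, LinearMap.comp_apply] at this
      rw [LinearMap.mem_ker, this]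
      congr 1
      exact Subtype.ext hz'
    have hey : e ⟨_, hy⟩ = y := by
      simp [e, Finsupp.notMem_support_iff.1 hi]
    have := ih (LinearMap.range e) ⟨_, hey⟩
      ((LinearMap.ker e).liftQ f hker ∘ₗ e.quotKerEquivRange.symm.toLinearMap)
    have hr : (⟨y, ⟨_, hey⟩⟩ : LinearMap.range e) =
        e.quotKerEquivRange (Submodule.Quotient.mk ⟨_, hy⟩) := Subtype.ext hey.symm
    rw [hr] at this
    simpa using this

theorem IsCosemisimple.exists_hom_ne_zero (hM : IsCosemisimple A M) (T : Type v) [AddCommGroup T]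
    [Module A T] [hsimple : IsSimpleModule A T] (hT : IsSubgeneratedBy A M T) :
    ∃ h : M →ₗ[A] T, h ≠ 0 := by
  by_contra! h0
  have hinj := hM T hsimple hT
  obtain ⟨G, _, _, ⟨I, q, hq⟩, i, hi⟩ := hT
  obtain ⟨t, ht⟩ := @exists_ne T (IsSimpleModule.nontrivial A T) 0
  obtain ⟨y, hy⟩ := hq (i t)
  let Y := (LinearMap.range i).comap q
  have := hinj.eq_zero_of_forall_hom_eq_zero h0 y Y ⟨t, hy.symm⟩
    ((LinearEquiv.ofInjective i hi).symm.toLinearMap ∘ₗ q.restrict (p := Y) fun _ h => h)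
  have hr : q.restrict (p := Y) (q := LinearMap.range i) (fun _ h => h) ⟨y, ⟨t, hy.symm⟩⟩ =
      LinearEquiv.ofInjective i hi t := Subtype.ext hy
  rw [LinearMap.comp_apply, hr] at this
  exact ht (by simpa using this)

/-- If the trace of `M` in `N` misses `x`, enlarge it to a submodule `L` maximal among those avoiding
`x`. The simple socle `T` of `N ⧸ L` receives a nonzero homomorphism from `M`, which lifts to a
homomorphism `M → N`; the image of the latter lies in the trace, hence in `L`, a contradiction. -/
theorem IsCosemisimple.isGeneratorOfSigma [Module.Finite A M] (hqp : IsQuasiProjective A M)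
    (hM : IsCosemisimple A M) : IsGeneratorOfSigma A M := by
  intro N _ _ hN
  rw [isGeneratedBy_iff_iSup_range, eq_top_iff]
  rintro x -
  by_contra hx
  obtain ⟨L, hL, -, hatom⟩ := exists_isAtom_span_mkQ _ hx
  set T := span A {L.mkQ x}
  have : IsSimpleModule A T := isSimpleModule_iff_isAtom.2 hatom
  obtain ⟨h, hh⟩ := hM.exists_hom_ne_zero T (hN.submodule_quotient L T)
  obtain ⟨G, _, _, ⟨I, q, hq⟩, i, hi⟩ := hN
  let j : N ⧸ L →ₗ[A] G ⧸ L.map i := L.mapQ (L.map i) i (le_comap_map i L)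
  have hj : Function.Injective j := injective_mapQ_map hi L
  obtain ⟨g, hg⟩ := hqp.exists_lift_finsupp ((L.map i).mkQ ∘ₗ q) ((mkQ_surjective _).comp hq)
    (j ∘ₗ T.subtype ∘ₗ h)
  -- the range of `q ∘ g` lies in `i N` because that of `j ∘ h` lies in `i N` modulo `i L`
  have hrange : ∀ m, q (g m) ∈ LinearMap.range i := by
    intro m
    obtain ⟨n, hn⟩ := L.mkQ_surjective (h m : N ⧸ L)
    have h1 := LinearMap.congr_fun hg m
    simp only [LinearMap.comp_apply, subtype_apply, ← hn] at h1
    obtain ⟨l, -, hl⟩ := (Submodule.Quotient.eq _).1 h1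
    exact ⟨l + n, by rw [map_add, hl]; abel⟩
  let φ : M →ₗ[A] N := (LinearEquiv.ofInjective i hi).symm.toLinearMap ∘ₗ
    (q ∘ₗ g).codRestrict (LinearMap.range i) hrange
  have hφ : ∀ m, i (φ m) = q (g m) := fun m => by
    have := (LinearEquiv.ofInjective i hi).apply_symm_apply
      ((q ∘ₗ g).codRestrict (LinearMap.range i) hrange m)
    exact congrArg Subtype.val this
  refine hh (LinearMap.ext fun m => Subtype.ext (hj ?_))
  have h1 := LinearMap.congr_fun hg m
  simp only [LinearMap.comp_apply, subtype_apply, ← hφ] at h1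
  have h2 : φ m ∈ L := hL (mem_iSup_of_mem φ ⟨m, rfl⟩)
  rw [← h1]
  simpa using mem_map_of_mem (f := i) h2

/-- Every submodule of a co-semisimple module is an intersection of maximal submodules. -/
theorem IsCosemisimple.exists_isCoatom (hM : IsCosemisimple A M) (K : Submodule A M) {x : M}
    (hx : x ∉ K) : ∃ P : Submodule A M, IsCoatom P ∧ K ≤ P ∧ x ∉ P := by
  obtain ⟨L, hKL, hxL, hatom⟩ := exists_isAtom_span_mkQ K hx
  set T := span A {L.mkQ x}
  have hsimple : IsSimpleModule A T := isSimpleModule_iff_isAtom.2 hatom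
  obtain ⟨g, hg⟩ := hM T hsimple ((isSubgeneratedBy_self A M).submodule_quotient L T)
    (T.comap L.mkQ) (Submodule.subtype _) (injective_subtype _) (L.mkQ.restrict fun _ h => h)
  have hgx : ∀ y (hy : L.mkQ y ∈ T), g y = ⟨L.mkQ y, hy⟩ := fun y hy =>
    LinearMap.congr_fun hg ⟨y, hy⟩
  have hx0 : g x ≠ 0 := by
    rw [hgx x (mem_span_singleton_self _)]
    simpa [Subtype.ext_iff] using hxL
  have hg0 : g ≠ 0 := fun h => hx0 (by simp [h])
  refine ⟨LinearMap.ker g, LinearMap.isCoatom_ker_of_surjective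
    (LinearMap.surjective_of_ne_zero hg0), fun y hy => ?_, hx0⟩
  have hy0 : L.mkQ y = 0 := by simpa using hKL hy
  rw [LinearMap.mem_ker, hgx y (by rw [hy0]; exact zero_mem _)]
  exact Subtype.ext hy0

/-- By Schur's lemma, the endomorphism of `M ⧸ P` induced by `φ` is zero as soon as its square
is. -/
theorem IsQuasiDuo.apply_mem_of_sq_range_le (hqd : IsQuasiDuo A M) {P : Submodule A M}
    (hP : IsCoatom P) {φ : Module.End A M} (hφ : LinearMap.range (φ * φ) ≤ P) (m : M) :
    φ m ∈ P := by
  have : IsSimpleModule A (M ⧸ P) := isSimpleModule_iff_isCoatom.2 hP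
  let ψ : M ⧸ P →ₗ[A] M ⧸ P := P.mapQ P φ (hqd P hP φ)
  rcases LinearMap.injective_or_eq_zero ψ with h | h
  · have h0 : ψ (P.mkQ (φ m)) = ψ 0 := by
      rw [map_zero]
      simpa [ψ] using hφ ⟨m, rfl⟩
    simpa using h h0
  · simpa [ψ] using LinearMap.congr_fun h (P.mkQ m)

/-! ### Strong regularity of the endomorphism ring -/

/-- A strongly regular ring is von Neumann regular and abelian, because it is reduced. -/
theorem isVonNeumannRegular_and_isAbelianRing_of_forall_eq_sq_mul {S : Type v} [Ring S]
    (h : ∀ a : S, ∃ x, a = a * a * x) : IsVonNeumannRegular S ∧ IsAbelianRing S := by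
  have hred : ∀ a : S, a * a = 0 → a = 0 := fun a ha => by
    obtain ⟨x, hx⟩ := h a
    rw [hx, ha, zero_mul]
  constructor
  · intro a
    obtain ⟨x, hx⟩ := h a
    refine ⟨x, (sub_eq_zero.1 (hred _ ?_))⟩
    calc (a * x * a - a) * (a * x * a - a)
        = a * x * (a * a * x) * a - a * x * (a * a) - (a * a * x) * a + a * a := by noncomm_ring
      _ = 0 := by rw [← hx]; noncomm_ring
  · intro e he a
    have he' : e * e = e := he
    have h1 : e * a * (1 - e) = 0 := hred _ (by
      calc e * a * (1 - e) * (e * a * (1 - e))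
          = e * a * (e - e * e) * (a * (1 - e)) := by noncomm_ring
        _ = 0 := by rw [he']; simp)
    have h2 : (1 - e) * a * e = 0 := hred _ (by
      calc (1 - e) * a * e * ((1 - e) * a * e)
          = (1 - e) * a * (e - e * e) * (a * e) := by noncomm_ring
        _ = 0 := by rw [he']; simp)
    have h3 : e * a = e * a * e := by
      rw [mul_sub, mul_one, sub_eq_zero] at h1; exact h1
    have h4 : a * e = e * a * e := by
      rw [sub_mul, one_mul, sub_mul, sub_eq_zero] at h2; exact h2
    exact h3.trans h4.symm

/-- No maximal submodule contains the range of `φ * φ` without containing that of `φ`, so the two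
ranges agree and `φ` lifts along `φ * φ`. -/
theorem IsCosemisimple.isAbelianEndoregular (hqp : IsQuasiProjective A M)
    (hM : IsCosemisimple A M) (hqd : IsQuasiDuo A M) : IsAbelianEndoregular A M := by
  refine isVonNeumannRegular_and_isAbelianRing_of_forall_eq_sq_mul fun φ => ?_
  obtain ⟨g, hg⟩ := hqp.exists_lift_of_range_le (a := φ * φ) (b := φ) (by
    rintro _ ⟨m, rfl⟩
    by_contra hm
    obtain ⟨P, hP, hle, hmP⟩ := hM.exists_isCoatom _ hm
    exact hmP (hqd.apply_mem_of_sq_range_le hP hle m))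
  exact ⟨g, hg.symm⟩

/-! ### Abelian endoregular generators -/

theorem IsAbelianRing.isIdempotentElem_add_sub_mul {S : Type v} [Ring S] (hS : IsAbelianRing S)
    {e f : S} (he : IsIdempotentElem e) (hf : IsIdempotentElem f) :
    IsIdempotentElem (e + f - e * f) := by
  have := (he.one_sub.mul_of_commute (hS _ he.one_sub _) hf.one_sub).one_sub
  convert this using 1
  noncomm_ring

/-- As `M` generates `N`, the element `x` is a sum of elements of images of endomorphisms with range
in `N`. Each such image is that of an idempotent, and finitely many central idempotents have a
join. -/
theorem IsAbelianEndoregular.exists_idempotent (hM : IsAbelianEndoregular A M)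
    (hgen : IsGeneratorOfSigma A M) (N : Submodule A M) {x : M} (hx : x ∈ N) :
    ∃ e : Module.End A M, IsIdempotentElem e ∧ LinearMap.range e ≤ N ∧ e x = x := by
  have htop := isGeneratedBy_iff_iSup_range.1 (hgen N ((isSubgeneratedBy_self A M).submodule N))
  suffices ∀ y : N, ∃ e : Module.End A M,
      IsIdempotentElem e ∧ LinearMap.range e ≤ N ∧ e y = y from this ⟨x, hx⟩
  intro y
  have hy : y ∈ ⨆ φ : M →ₗ[A] N, LinearMap.range φ := htop ▸ mem_top
  refine iSup_induction (motive := fun y : N => ∃ e : Module.End A M,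
    IsIdempotentElem e ∧ LinearMap.range e ≤ N ∧ e y = y) _ hy (fun φ y hy => ?_)
    ⟨0, IsIdempotentElem.zero, by simp, by simp⟩ fun y z hy hz => ?_
  · -- for `a = a * b * a`, the idempotent `a * b` fixes the image of `a`
    obtain ⟨m, rfl⟩ := hy
    let a : Module.End A M := N.subtype ∘ₗ φ
    obtain ⟨b, hb⟩ := hM.1 a
    refine ⟨a * b, ?_, ?_, LinearMap.congr_fun hb m⟩
    · rw [IsIdempotentElem, ← mul_assoc, hb]
    · rintro _ ⟨z, rfl⟩
      exact (φ (b z)).2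
  · obtain ⟨e, he, heN, hey⟩ := hy
    obtain ⟨f, hf, hfN, hfz⟩ := hz
    refine ⟨e + f - e * f, hM.2.isIdempotentElem_add_sub_mul he hf, ?_, ?_⟩
    · rintro _ ⟨w, rfl⟩
      exact sub_mem (add_mem (heN ⟨w, rfl⟩) (hfN ⟨w, rfl⟩)) (heN ⟨f w, rfl⟩)
    · have h1 : e (f y) = f y := by
        have := LinearMap.congr_fun (hM.2 e he f) y
        simpa [hey] using this
      simp only [LinearMap.sub_apply, LinearMap.add_apply, Module.End.mul_apply, coe_add, map_add,
        hey, hfz, h1]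
      abel

theorem IsAbelianEndoregular.isDuo (hM : IsAbelianEndoregular A M)
    (hgen : IsGeneratorOfSigma A M) : IsDuo A M := by
  intro N φ x hx
  obtain ⟨e, he, heN, hex⟩ := hM.exists_idempotent hgen N hx
  refine heN ⟨φ x, ?_⟩
  have := LinearMap.congr_fun (hM.2 e he φ) x
  simpa [hex] using this

theorem IsAbelianEndoregular.cyclicSubmodulesAreSummands (hM : IsAbelianEndoregular A M)
    (hgen : IsGeneratorOfSigma A M) : CyclicSubmodulesAreSummands A M := by
  intro x
  obtain ⟨e, he, heN, hex⟩ := hM.exists_idempotent hgen _ (mem_span_singleton_self x)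
  have : span A {x} = LinearMap.range e :=
    le_antisymm ((span_singleton_le_iff_mem _ _).2 ⟨x, hex⟩) heN
  exact ⟨LinearMap.ker e, this ▸ LinearMap.IsIdempotentElem.isCompl he⟩

/-! ### Duo modules whose cyclic submodules are summands -/

/-- The range and the kernel of an idempotent are both fully invariant, so it commutes with every
endomorphism. -/
theorem IsDuo.isAbelianRing_end (hM : IsDuo A M) : IsAbelianRing (Module.End A M) := by
  intro e he φ
  have he' : ∀ m, e (e m) = e m := fun m => LinearMap.congr_fun he m
  refine LinearMap.ext fun m => ?_
  change e (φ m) = φ (e m)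
  obtain ⟨n, hn⟩ := hM (LinearMap.range e) φ (⟨m, rfl⟩ : e m ∈ LinearMap.range e)
  have hk : e (φ (m - e m)) = 0 :=
    hM (LinearMap.ker e) φ (show e (m - e m) = 0 by rw [map_sub, he', sub_self])
  rw [map_sub, map_sub, ← hn, he', sub_eq_zero] at hk
  rw [hk, hn]

theorem CyclicSubmodulesAreSummands.exists_idempotent (hM : CyclicSubmodulesAreSummands A M)
    (x : M) : ∃ e : Module.End A M, IsIdempotentElem e ∧ LinearMap.range e = span A {x} := by
  obtain ⟨K, hK⟩ := hM x
  exact ⟨_, isIdempotentElem_projection hK, range_projection hK⟩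

/-- To extend `f : N → T`, choose `x` with `f x ≠ 0` and let `e` be the idempotent with range
generated by `η x`; the extension is `f` composed with `e`. It agrees with `f`: if not, `T` is a
quotient of `M` through `e` and also through an idempotent generated by an element killed by `e`,
and a lift of one quotient map along the other is incompatible with `e` being central. -/
theorem IsDuo.isCosemisimple (hqp : IsQuasiProjective A M) (hM : IsDuo A M)
    (hcyc : CyclicSubmodulesAreSummands A M) : IsCosemisimple A M := by
  intro T _ _ hsimple _ N _ _ η hη f
  by_cases hf : f = 0
  · exact ⟨0, by simp [hf]⟩
  -- the projection onto the cyclic submodule of `η y` factors through `η`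
  have key : ∀ y : N, ∃ (e : Module.End A M) (u : M →ₗ[A] N), IsIdempotentElem e ∧
      (∀ m, η (u m) = e m) ∧ u (η y) = y := by
    intro y
    obtain ⟨e, he, hey⟩ := hcyc.exists_idempotent (η y)
    have hr : ∀ m, e m ∈ LinearMap.range η := fun m => by
      have : e m ∈ span A {η y} := hey.le ⟨m, rfl⟩
      exact (span_singleton_le_iff_mem (η y) (LinearMap.range η)).2 ⟨y, rfl⟩ this
    let u : M →ₗ[A] N := (LinearEquiv.ofInjective η hη).symm.toLinearMap ∘ₗ
      e.codRestrict (LinearMap.range η) hr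
    have hu : ∀ m, η (u m) = e m := fun m =>
      congrArg Subtype.val ((LinearEquiv.ofInjective η hη).apply_symm_apply
        (e.codRestrict (LinearMap.range η) hr m))
    refine ⟨e, u, he, hu, hη ?_⟩
    obtain ⟨n, hn⟩ : η y ∈ LinearMap.range e := hey ▸ mem_span_singleton_self _
    rw [hu, ← hn]
    exact LinearMap.congr_fun he n
  obtain ⟨x, hx⟩ : ∃ x, f x ≠ 0 := by
    by_contra! h
    exact hf (LinearMap.ext h)
  obtain ⟨e, u, he, hu, hux⟩ := key x
  refine ⟨f ∘ₗ u, LinearMap.ext fun y => ?_⟩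
  -- `z` is the part of `y` killed by `e`, and `f` has to vanish on it
  set z := y - u (η y)
  suffices hz : f z = 0 by
    rw [map_sub, sub_eq_zero] at hz
    exact hz.symm
  have hez : e (η z) = 0 := by
    rw [map_sub, hu, map_sub, sub_eq_zero]
    exact (LinearMap.congr_fun he (η y)).symm
  obtain ⟨_, u', -, -, hu'z⟩ := key z
  have hfu : Function.Surjective (f ∘ₗ u) := LinearMap.surjective_of_ne_zero fun h => hx (by
    simpa [hux] using LinearMap.congr_fun h (η x))
  obtain ⟨g, hg⟩ := hqp T (f ∘ₗ u) hfu (f ∘ₗ u')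
  have h1 : f (u (g (η z))) = f z := by
    simpa [hu'z] using LinearMap.congr_fun hg (η z)
  have h2 : u (g (η z)) = 0 := hη (by
    have hc : e (g (η z)) = g (e (η z)) :=
      LinearMap.congr_fun (hM.isAbelianRing_end e he g) (η z)
    rw [hu, hc, hez, map_zero, map_zero])
  rw [← h1, h2, map_zero]

end AuxiliaryModules

/-- Right `R`-modules are modules over `Rᵐᵒᵖ`. -/
theorem mainTheorem7 (R : Type u) [Ring R] (M : Type v) [AddCommGroup M] [Module Rᵐᵒᵖ M]
    (hfg : Module.Finite Rᵐᵒᵖ M) (hqp : IsQuasiProjective Rᵐᵒᵖ M) :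
    List.TFAE [
      IsAbelianEndoregular Rᵐᵒᵖ M ∧ IsGeneratorOfSigma Rᵐᵒᵖ M,
      IsCosemisimple Rᵐᵒᵖ M ∧ IsQuasiDuo Rᵐᵒᵖ M,
      IsDuo Rᵐᵒᵖ M ∧ IsGeneratorOfSigma Rᵐᵒᵖ M ∧ CyclicSubmodulesAreSummands Rᵐᵒᵖ M] := by
  tfae_have 1 → 3 := fun ⟨h, hgen⟩ =>
    ⟨h.isDuo hgen, hgen, h.cyclicSubmodulesAreSummands hgen⟩
  tfae_have 3 → 2 := fun ⟨hduo, _, hcyc⟩ =>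
    ⟨hduo.isCosemisimple hqp hcyc, fun N _ => hduo N⟩
  tfae_have 2 → 1 := fun ⟨h, hqd⟩ => ⟨h.isAbelianEndoregular hqp hqd, h.isGeneratorOfSigma hqp⟩
  tfae_finish
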